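/- Let $\sigma_1,\sigma_2$ be the standard generators of the braid group $B_3$ (positive crossings), let $a,b,c,d\ge 1$ be integers, $\beta=\sigma_1^{a}\sigma_2^{b}\sigma_1^{c}\sigma_2^{d}$, $w=a+b+c+d$ the exponent sum (writhe) of $\beta$ and $w^*=w-a=b+c+d$. Let $V_{\widehat\beta}(t)$ be the Jones polynomial of the closure $\widehat\beta$ (normalized to $1$ on the unknot, with $t^{-1}V_{D_+}-tV_{D_-}=(t^{1/2}-t^{-1/2})V_{D_0}$), and define $V^*_{\widehat\beta}$ by $V_{\widehat\beta}=t^{(w-2)/2}\,V^*_{\widehat\beta}$. Let $T_s=T(2,s)$ be the two-strand torus link, the closure of the 2-braid $\sigma_1^s$. Put $\epsilon_k=(-1)^k$, $$A_s=\sum_{j=0}^{s-1}\epsilon_j t^{s-1-j}=\frac{t^s+\epsilon_{s-1}}{t+1},\qquad L(n)=\sum_{j=0}^{n}\epsilon_j(1+n-j)t^{n-j},\qquad R(n)=\sum_{j=0}^{n}\epsilon_j(j+1)t^{n-j},$$ with $L(-1)=R(-1)=0$. Suppose $a\ge w^*$. Let $f$ be the part of the polynomial $A_aA_bA_cA_d$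 in degrees $<w^*-3$, and let $t^a g$ be its part in degrees $a,\dots,a+w^*-4$. Then $$A_aA_bA_cA_d=f+\epsilon_{3+w^*}\,bcd\;t^{w^*-3}A_{a+3-w^*}+t^{a}g .$$ If $b=c=d=1$ then $f=g=0$ and $\widehat\beta=T_{a+2}$; otherwise $\deg f=\deg g=w^*-4$. Moreover $V^*_{\widehat\beta}\in\mathbb Z[t]$ and $$V^*_{\widehat\beta}=B_1+t^{w^*+1}G+t^{a+2}B_2,$$ where $$\begin{aligned} B_1={}&\epsilon_w(1+t^2)+\epsilon_{a+c}t^{b+d+1}+\epsilon_a t^{c+2}A_bA_d+2\epsilon_{a+c-1}t^2A_bA_d\\ &+\epsilon_{a+c+d}t^2L(b-2)+b\,\epsilon_a t^{b+1}A_{c+d}+\epsilon_{a+b+c}t^2L(d-2)+d\,\epsilon_a t^{d+1}A_{b+c}\\ &+t^3f+\epsilon_{a+1}bcd\,t^{w^*},\\ G={}&\epsilon_{w^*}(bcd-b-d)A_{a+1-w^*},\\ B_2={}&\epsilon_{b+d}t^{c-1}+\epsilon_dA_bA_c+\epsilon_cA_bA_d+\epsilon_bA_cA_d\\ &+\epsilon_{c+d}R(b-2)+\epsilon_{b+c}R(d-2)+\epsilon_{1+w^*}bcd+t\,g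 . \end{aligned}$$ Here $\deg B_1\le w^*$, $\deg G\le a-w^*$ and $\deg B_2\le w^*-3$ (the zero polynomial being allowed), so that the three summands occupy the disjoint ranges of degrees $[0,w^*]$, $[w^*+1,a+1]$ and $[a+2,w-1]$. In particular $\deg V^*_{\widehat\beta}\le w-1$, and equality holds exactly when either $\min(b,d)=c=1$, in which case $\widehat\beta=T_{w-1}$, or $\min(b,c,d)\ge2$. -/

import Mathlib

open Polynomial

namespace TwistedLinks

/-- Braid words on `n + 1` strands. The letter `(i, true)` is the generator crossing the strands in
positions `i` and `i + 1` (counted from zero) positively, and `(i, false)` is its inverse. -/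
abbrev BraidWord (n : ℕ) : Type := List (Fin n × Bool)

/-- The relators of Artin's presentation of the braid group on `n + 1` strands. -/
def artinRelators (n : ℕ) : Set (FreeGroup (Fin n)) :=
  {r | ∃ i j : Fin n, (i : ℕ) + 1 < j ∧
      r = (FreeGroup.of i * FreeGroup.of j) * (FreeGroup.of j * FreeGroup.of i)⁻¹} ∪
  {r | ∃ i j : Fin n, (i : ℕ) + 1 = j ∧
      r = (FreeGroup.of i * FreeGroup.of j * FreeGroup.of i) *
        (FreeGroup.of j * FreeGroup.of i * FreeGroup.of j)⁻¹}

/-- Artin's braid group on `n + 1` strands. -/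
abbrev BraidGroup (n : ℕ) : Type := PresentedGroup (artinRelators n)

/-- The braid represented by a braid word. -/
def BraidWord.toBraid {n : ℕ} (u : BraidWord n) : BraidGroup n :=
  PresentedGroup.mk (artinRelators n) (FreeGroup.mk u)

/-- Add one more strand on the right, and one crossing of either sign between the two rightmost
strands, at the end of the word. -/
def BraidWord.stabilize {n : ℕ} (u : BraidWord n) (s : Bool) : BraidWord (n + 1) :=
  u.map (fun x => (x.1.castSucc, x.2)) ++ [(Fin.last n, s)]

/-- `SameClosure u v` says that the closures of the braid words `u` and `v`, possibly with different
numbers of strands, are the same oriented link, expressed through Markov's moves: equality in the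
braid group, conjugation (cyclic rotation of the word), and (de)stabilization. -/
inductive SameClosure : ∀ {m n : ℕ}, BraidWord m → BraidWord n → Prop
  | braid {n : ℕ} {u v : BraidWord n} (h : u.toBraid = v.toBraid) : SameClosure u v
  | conj {n : ℕ} (u v : BraidWord n) : SameClosure (u ++ v) (v ++ u)
  | stab {n : ℕ} (u : BraidWord n) (s : Bool) : SameClosure u (u.stabilize s)
  | symm {m n : ℕ} {u : BraidWord m} {v : BraidWord n} (h : SameClosure u v) : SameClosure v u
  | trans {l m n : ℕ} {u : BraidWord l} {v : BraidWord m} {x : BraidWord n}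
      (h : SameClosure u v) (k : SameClosure v x) : SameClosure u x

/-- The exponent sum of a braid word, which is the writhe of its closed diagram. -/
def writhe {n : ℕ} (u : BraidWord n) : ℤ :=
  (u.map (fun x => if x.2 then (1 : ℤ) else -1)).sum

/-- The standard closed diagram of `u` is cut at the levels `0, …, u.length`, its `k`-th crossing
lying between the levels `k` and `k + 1`; the points of the diagram at these levels are the pairs
(level, position). A Kauffman state `s` smooths each crossing, along the strands (`true`, two
vertical arcs) or across them (`false`, a cup and a cap). `StateArc u s p q` says that an arc of the
smoothed closed diagram joins `p` to `q`. -/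
inductive StateArc {n : ℕ} (u : BraidWord n) (s : Fin u.length → Bool) :
    Fin (u.length + 1) × Fin (n + 1) → Fin (u.length + 1) × Fin (n + 1) → Prop
  | strand (k : Fin u.length) (j : Fin (n + 1))
      (h : s k = true ∨ (j ≠ (u.get k).1.castSucc ∧ j ≠ (u.get k).1.succ)) :
      StateArc u s (k.castSucc, j) (k.succ, j)
  | upper (k : Fin u.length) (h : s k = false) :
      StateArc u s (k.castSucc, (u.get k).1.castSucc) (k.castSucc, (u.get k).1.succ)
  | lower (k : Fin u.length) (h : s k = false) :
      StateArc u s (k.succ, (u.get k).1.castSucc) (k.succ, (u.get k).1.succ)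
  | closing (j : Fin (n + 1)) : StateArc u s (Fin.last u.length, j) (0, j)

/-- The number of circles of a Kauffman state: the number of classes of the equivalence relation on
the points that its arcs generate. -/
noncomputable def circles {n : ℕ} (u : BraidWord n) (s : Fin u.length → Bool) : ℕ :=
  Nat.card (Quot (StateArc u s))

/-- The Kauffman bracket, normalized to `1` on a circle, of the closed diagram of a braid word. The
variable of the ring of Laurent polynomials is `t ^ (1/4)`, so Kauffman's variable
`A = t ^ (-1/4)` is `T (-1)`. -/
noncomputable def bracket {n : ℕ} (u : BraidWord n) : LaurentPolynomial ℤ :=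
  ∑ s : Fin u.length → Bool,
    (∏ k, if s k = (u.get k).2 then LaurentPolynomial.T (-1) else LaurentPolynomial.T 1) *
      (-LaurentPolynomial.T (-2) - LaurentPolynomial.T 2) ^ (circles u s - 1)

/-- The Jones polynomial `(-A ^ 3) ^ (-writhe) * bracket` of the closure of a braid word, as a
Laurent polynomial in `t ^ (1/4)`. -/
noncomputable def jones {n : ℕ} (u : BraidWord n) : LaurentPolynomial ℤ :=
  ((writhe u).negOnePow : ℤ) • (LaurentPolynomial.T (3 * writhe u) * bracket u)

/-- A polynomial in `t`, regarded as a Laurent polynomial in `t ^ (1/4)`. -/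
noncomputable def inQuarterPowers (p : ℤ[X]) : LaurentPolynomial ℤ :=
  aeval (LaurentPolynomial.T 4 : LaurentPolynomial ℤ) p

/-- The normalization `V* = t ^ (-(w - 2) / 2) * V` of the Jones polynomial of the closure of a
braid word of writhe `w`, as a Laurent polynomial in `t ^ (1/4)`. -/
noncomputable def jonesStar {n : ℕ} (u : BraidWord n) : LaurentPolynomial ℤ :=
  LaurentPolynomial.T (-2 * (writhe u - 2)) * jones u

/-- The 3-braid word `σ₁ ^ a σ₂ ^ b σ₁ ^ c σ₂ ^ d`. -/
def rankTwoWord (a b c d : ℕ) : BraidWord 2 :=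
  List.replicate a (0, true) ++ List.replicate b (1, true) ++
    List.replicate c (0, true) ++ List.replicate d (1, true)

/-- The 2-braid word `σ₁ ^ s`, whose closure is the torus link `T(2, s)`. -/
def twoStrandTorusWord (s : ℕ) : BraidWord 1 := List.replicate s (0, true)

/-- The sign `ε_k = (-1) ^ k`. -/
noncomputable def eps (k : ℕ) : ℤ[X] := (-1) ^ k

/-- `A_w = (t ^ w + (-1) ^ (w - 1)) / (t + 1) = t ^ (w - 1) - t ^ (w - 2) + ⋯`. -/
noncomputable def altPoly (w : ℕ) : ℤ[X] := ∑ j ∈ Finset.range w, eps j * X ^ (w - 1 - j)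

/-- `L(b) = ∑_{j=0}^{b} (-1) ^ j (1 + b - j) t ^ (b - j)`, an empty sum if `b < 0`. -/
noncomputable def incPoly (b : ℤ) : ℤ[X] :=
  ∑ j ∈ Finset.range (b + 1).toNat, eps j * C (1 + b - j) * X ^ (b - j).toNat

/-- `R(b) = ∑_{j=0}^{b} (-1) ^ j (j + 1) t ^ (b - j)`, an empty sum if `b < 0`. -/
noncomputable def decPoly (b : ℤ) : ℤ[X] :=
  ∑ j ∈ Finset.range (b + 1).toNat, eps j * C ((j : ℤ) + 1) * X ^ (b - j).toNat

/-- The product `A_a A_b A_c A_d`. -/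
noncomputable def altProd (a b c d : ℕ) : ℤ[X] := altPoly a * altPoly b * altPoly c * altPoly d

/-- The part of `A_a A_b A_c A_d` in degrees below `b + c + d - 3`. -/
noncomputable def lowPart (a b c d : ℕ) : ℤ[X] :=
  ∑ j ∈ Finset.range (b + c + d - 3), C ((altProd a b c d).coeff j) * X ^ j

/-- The part of `A_a A_b A_c A_d` in degrees `a, …, a + b + c + d - 4`, divided by `t ^ a`. -/
noncomputable def highPart (a b c d : ℕ) : ℤ[X] :=
  ∑ j ∈ Finset.range (b + c + d - 3), C ((altProd a b c d).coeff (a + j)) * X ^ j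

/-- The first block. -/
noncomputable def blockOne (a b c d : ℕ) : ℤ[X] :=
  eps (a + b + c + d) * (1 + X ^ 2) + eps (a + c) * X ^ (b + d + 1)
    + eps a * X ^ (c + 2) * altPoly b * altPoly d
    + 2 * eps (a + c - 1) * X ^ 2 * altPoly b * altPoly d
    + eps (a + c + d) * X ^ 2 * incPoly ((b : ℤ) - 2)
    + (b : ℤ[X]) * eps a * X ^ (b + 1) * altPoly (c + d)
    + eps (a + b + c) * X ^ 2 * incPoly ((d : ℤ) - 2)
    + (d : ℤ[X]) * eps a * X ^ (d + 1) * altPoly (b + c)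
    + X ^ 3 * lowPart a b c d
    + eps (a + 1) * ((b * c * d : ℕ) : ℤ[X]) * X ^ (b + c + d)

/-- The gap between the two blocks. -/
noncomputable def gap (a b c d : ℕ) : ℤ[X] :=
  eps (b + c + d) * C ((b : ℤ) * c * d - b - d) * altPoly (a + 1 - (b + c + d))

/-- The second block. -/
noncomputable def blockTwo (a b c d : ℕ) : ℤ[X] :=
  eps (b + d) * X ^ (c - 1) + eps d * altPoly b * altPoly c + eps c * altPoly b * altPoly d
    + eps b * altPoly c * altPoly d
    + eps (c + d) * decPoly ((b : ℤ) - 2) + eps (b + c) * decPoly ((d : ℤ) - 2)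
    + eps (1 + (b + c + d)) * ((b * c * d : ℕ) : ℤ[X])
    + X * highPart a b c d

end TwistedLinks

open TwistedLinks

/-! In the Kauffman bracket each twist region `σ_i ^ n` acts as `A ^ n (1 + t ^ (1/2) P_n e_i)`,
with `e_i` the cup-cap diagram and `P_n = (1 - (-t) ^ n) / (1 + t)`; note that `P_n = ε_{n-1} A_n`.
Four regions leave sixteen closed diagrams in the `e_i`, each a power of the circle value `δ`, and
`t ^ (1/2) δ = -(1 + t)`. This gives the closed form `rankTwoPoly` (`jonesStar_rankTwoWord`).
Circles are counted by two-colourings: `2 ^ circles` is the trace of a product of small transfer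
matrices (`two_pow_circles`), so the Temperley–Lieb relations become finite matrix computations.

The only quartic term is `± t ^ 3 A_a A_b A_c A_d`. Below degree `a`, multiplication by `A_a`
produces signed alternating partial sums of the coefficients of `q = A_b A_c A_d`. From degree `deg
q = w* - 3` on, these are complete and equal `± q(-1) = ± bcd`; this is the middle band of
`altProd_decomposition`. After multiplication by `t ^ 3`, `f` goes into the first block and `g` into
the second, and all remaining terms have closed forms over `(1 + t) ^ 2`, so the decomposition of
`V*` is one identity of rational functions (`block_identity`).

Equality in the degree bound is read off from the coefficient of degree `w* - 3` in the second block
(`blockTwo_coeff_top`). The torus links come from sliding a power through `σ₁σ₂` or `σ₂σ₁` with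
Artin's relation and destabilizing. -/

namespace TwistedLinks

/-! ### Circles of a state as the trace of a transfer matrix -/

/-- The transfer matrix of a smoothing of a crossing: rows and columns are indexed by the two-colourings
of a level, and the entry is `1` when the colours agree along the arcs. -/
def smoothing {n : ℕ} (x : Fin n × Bool) :
    Matrix (Fin (n + 1) → Bool) (Fin (n + 1) → Bool) ℕ :=
  Matrix.of fun p q =>
    if (∀ j, (x.2 = true ∨ (j ≠ x.1.castSucc ∧ j ≠ x.1.succ)) → p j = q j) ∧
      (x.2 = false → p x.1.castSucc = p x.1.succ ∧ q x.1.castSucc = q x.1.succ) then 1 else 0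

lemma smoothing_vertical {n : ℕ} (i : Fin n) : smoothing (i, true) = 1 := by
  ext p q
  simp [smoothing, Matrix.one_apply, funext_iff]

/-- The transfer matrix of a sequence of smoothings. -/
def stateMatrix {n : ℕ} (l : List (Fin n × Bool)) :
    Matrix (Fin (n + 1) → Bool) (Fin (n + 1) → Bool) ℕ :=
  (l.map smoothing).prod

lemma list_prod_apply_eq_sum_paths {ι : Type*} [Fintype ι] [DecidableEq ι] (m : ℕ)
    (M : Fin m → Matrix ι ι ℕ) (x y : ι) :
    (List.ofFn M).prod x y = ∑ f : Fin (m + 1) → ι,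
      if f 0 = x ∧ f (Fin.last m) = y then ∏ k : Fin m, M k (f k.castSucc) (f k.succ) else 0 := by
  induction m generalizing x with
  | zero =>
    rw [← (Equiv.funUnique (Fin 1) ι).symm.sum_comp]
    simp only [List.ofFn_zero, List.prod_nil, Matrix.one_apply, Finset.univ_eq_empty,
      Finset.prod_empty]
    simp only [Equiv.funUnique_symm_apply, uniqueElim_const, Fin.last_zero]
    by_cases h : x = y
    · subst h; simp
    · rw [if_neg h, Finset.sum_eq_zero]
      rintro z -
      rw [if_neg]
      rintro ⟨rfl, rfl⟩
      exact h rfl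
  | succ m ih =>
    rw [List.ofFn_succ, List.prod_cons, Matrix.mul_apply]
    rw [← (Fin.consEquiv (fun _ : Fin (m + 2) => ι)).sum_comp, Fintype.sum_prod_type]
    simp only [Fin.consEquiv_apply, Fin.cons_zero, Fin.prod_univ_succ, Fin.castSucc_zero,
      Fin.cons_succ, ← Fin.succ_last, ← Fin.succ_castSucc]
    conv_rhs => rw [Finset.sum_eq_single x (fun b _ hb =>
      Finset.sum_eq_zero fun f _ => if_neg fun h => hb h.1) (by simp)]
    simp only [ih, Finset.mul_sum]
    rw [Finset.sum_comm]
    refine Finset.sum_congr rfl fun f _ => ?_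
    rw [Finset.sum_eq_single (f 0)]
    · simp
    · intro b _ hb
      rw [if_neg (fun h => hb h.1.symm), mul_zero]
    · simp

/-- Both sides count the two-colourings of the points that are constant along arcs. Read level by
level, such a colouring is a path of level colourings with nonzero matrix entries, and the closing
arcs make the path periodic, hence the trace. -/
lemma two_pow_circles {n : ℕ} (u : BraidWord n) (s : Fin u.length → Bool) :
    2 ^ circles u s =
      (List.ofFn fun k => smoothing ((u.get k).1, s k)).prod.trace := by
  classical
  have hfin : Finite (Quot (StateArc u s)) := Quot.finite _
  have := Fintype.ofFinite (Quot (StateArc u s))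
  have e1 : (Quot (StateArc u s) → Bool) ≃
      {f : Fin (u.length + 1) × Fin (n + 1) → Bool // ∀ p q, StateArc u s p q → f p = f q} :=
    { toFun := fun g => ⟨fun p => g (Quot.mk _ p), fun p q h => congrArg g (Quot.sound h)⟩
      invFun := fun f => Quot.lift f.1 f.2
      left_inv := fun g => by
        funext q
        induction q using Quot.ind
        rfl
      right_inv := fun f => rfl }
  have e2 : {f : Fin (u.length + 1) × Fin (n + 1) → Bool // ∀ p q, StateArc u s p q → f p = f q} ≃
      {f : Fin (u.length + 1) → Fin (n + 1) → Bool // f (Fin.last _) = f 0 ∧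
        ∀ k : Fin u.length, smoothing ((u.get k).1, s k) (f k.castSucc) (f k.succ) = 1} := by
    refine (Equiv.curry _ _ _).subtypeEquiv fun f => ?_
    constructor
    · intro h
      refine ⟨funext fun j => h _ _ (.closing j), fun k => ?_⟩
      simp only [smoothing, Matrix.of_apply]
      rw [if_pos]
      exact ⟨fun j hj => h _ _ (.strand k j hj),
        fun hk => ⟨h _ _ (.upper k hk), h _ _ (.lower k hk)⟩⟩
    · rintro ⟨h1, h2⟩ p q hpq
      have h3 := fun k => by
        have := h2 k
        simp only [smoothing, Matrix.of_apply] at this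
        exact (by_contra fun hn => by rw [if_neg hn] at this; exact zero_ne_one this : _ ∧ _)
      cases hpq with
      | strand k j h => exact (h3 k).1 j h
      | upper k h => exact ((h3 k).2 h).1
      | lower k h => exact ((h3 k).2 h).2
      | closing j => exact congrFun h1 j
  have hcard : 2 ^ circles u s = Fintype.card {f : Fin (u.length + 1) → Fin (n + 1) → Bool //
      f (Fin.last _) = f 0 ∧
        ∀ k : Fin u.length, smoothing ((u.get k).1, s k) (f k.castSucc) (f k.succ) = 1} := by
    rw [← Fintype.card_congr (e1.trans e2), Fintype.card_fun, Fintype.card_bool, circles,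
      Nat.card_eq_fintype_card]
  rw [hcard, Fintype.card_subtype, Finset.card_filter, Matrix.trace]
  simp only [Matrix.diag_apply, list_prod_apply_eq_sum_paths]
  rw [Finset.sum_comm]
  refine Finset.sum_congr rfl fun f _ => ?_
  -- The diagonal index of the trace is forced to be the colouring of level `0`.
  rw [Finset.sum_eq_single (f 0)]
  · by_cases h : f (Fin.last _) = f 0
    · simp only [h, true_and, if_true]
      split_ifs with h'
      · rw [Finset.prod_eq_one fun k _ => h' k]
      · push Not at h'
        obtain ⟨k, hk⟩ := h'
        refine (Finset.prod_eq_zero (Finset.mem_univ k) ?_).symm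
        simp only [smoothing, Matrix.of_apply] at hk ⊢
        rw [if_neg]
        intro hn
        exact hk (if_pos hn)
    · simp [h]
  · intro b _ hb
    rw [if_neg]
    exact fun h => hb h.1.symm
  · simp

lemma circles_pos {n : ℕ} (u : BraidWord n) (s : Fin u.length → Bool) : 0 < circles u s := by
  have : Finite (Quot (StateArc u s)) := Quot.finite _
  have : Nonempty (Quot (StateArc u s)) := ⟨Quot.mk _ (0, 0)⟩
  exact Nat.card_pos

/-- The number of circles of a sequence of smoothings. -/
noncomputable def loops {n : ℕ} (l : List (Fin n × Bool)) : ℕ := circles l fun k => (l.get k).2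

lemma two_pow_loops {n : ℕ} (l : List (Fin n × Bool)) :
    2 ^ loops l = (stateMatrix l).trace := by
  rw [loops, two_pow_circles, stateMatrix]
  congr 2
  conv_rhs => rw [← List.ofFn_get l, List.map_ofFn]
  rfl

lemma loops_pos {n : ℕ} (l : List (Fin n × Bool)) : 0 < loops l := circles_pos _ _

lemma loops_eq_of_trace {n k : ℕ} {l : List (Fin n × Bool)}
    (h : (stateMatrix l).trace = 2 ^ k) : loops l = k :=
  Nat.pow_right_injective le_rfl ((two_pow_loops l).trans h)

lemma circles_eq_loops {n : ℕ} (u : BraidWord n) (s : Fin u.length → Bool) :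
    circles u s = loops (List.ofFn fun k => ((u.get k).1, s k)) := by
  refine (loops_eq_of_trace ?_).symm
  rw [two_pow_circles, stateMatrix, List.map_ofFn]
  rfl

/-! ### Temperley–Lieb relations and the bracket of a twist region -/

lemma cupCap_mul_self (i : Fin 2) :
    smoothing (i, false) * smoothing (i, false) = 2 • smoothing (i, false) := by
  revert i; decide +kernel

/-- One of the two zigzag relations suffices: words in which the other would occur are handled by
cyclic rotation. -/
lemma cupCap_mul_cupCap_mul_cupCap :
    smoothing ((0 : Fin 2), false) * (smoothing (1, false) * smoothing (0, false)) =
      smoothing (0, false) := by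
  decide +kernel

lemma trace_cupCap (i : Fin 2) : (smoothing (i, false)).trace = 4 := by
  revert i; decide +kernel

lemma trace_cupCap_mul_cupCap :
    (smoothing ((0 : Fin 2), false) * smoothing (1, false)).trace = 2 := by
  decide +kernel

/-- The value of a circle in the Kauffman bracket. -/
noncomputable def circleValue : LaurentPolynomial ℤ :=
  -LaurentPolynomial.T (-2) - LaurentPolynomial.T 2

/-- The Kauffman bracket of a sequence of smoothings. -/
noncomputable def stateValue {n : ℕ} (l : List (Fin n × Bool)) : LaurentPolynomial ℤ :=
  circleValue ^ (loops l - 1)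

lemma stateValue_of_trace {n k : ℕ} {l : List (Fin n × Bool)}
    (h : (stateMatrix l).trace = 2 ^ (k + 1)) : stateValue l = circleValue ^ k := by
  rw [stateValue, loops_eq_of_trace h, Nat.add_sub_cancel]

/-- The Kauffman bracket of the closure of `l ++ u`, where the crossings of `l` are already
smoothed. -/
noncomputable def stateSum {n : ℕ} : List (Fin n × Bool) → BraidWord n → LaurentPolynomial ℤ
  | l, [] => stateValue l
  | l, x :: u =>
    (if true = x.2 then LaurentPolynomial.T (-1) else LaurentPolynomial.T 1) *
        stateSum (l ++ [(x.1, true)]) u +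
      (if false = x.2 then LaurentPolynomial.T (-1) else LaurentPolynomial.T 1) *
        stateSum (l ++ [(x.1, false)]) u

lemma stateSum_eq_sum {n : ℕ} (l : List (Fin n × Bool)) (u : BraidWord n) :
    stateSum l u = ∑ s : Fin u.length → Bool,
      (∏ k, if s k = (u.get k).2 then LaurentPolynomial.T (-1) else LaurentPolynomial.T 1) *
        stateValue (l ++ List.ofFn fun k => ((u.get k).1, s k)) := by
  induction u generalizing l with
  | nil => simp [stateSum]
  | cons x u ih =>
    rw [stateSum, ih, ih]
    simp only [List.length_cons]
    rw [← (Fin.consEquiv (fun _ : Fin (u.length + 1) => Bool)).sum_comp, Fintype.sum_prod_type,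
      Fintype.sum_bool, Finset.mul_sum, Finset.mul_sum]
    simp [Fin.prod_univ_succ, List.ofFn_succ, mul_assoc, Fin.consEquiv]

lemma bracket_eq_stateSum {n : ℕ} (u : BraidWord n) : bracket u = stateSum [] u := by
  rw [stateSum_eq_sum, bracket]
  simp only [stateValue, List.nil_append, circles_eq_loops, circleValue]

lemma stateMatrix_singleton {n : ℕ} (x : Fin n × Bool) : stateMatrix [x] = smoothing x := by
  simp [stateMatrix]

lemma stateMatrix_append {n : ℕ} (l l' : List (Fin n × Bool)) :
    stateMatrix (l ++ l') = stateMatrix l * stateMatrix l' := by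
  simp [stateMatrix]

/-- The circle count is determined by a trace, so the smoothed prefix matters only through its
matrix. -/
lemma stateSum_congr {n : ℕ} {l l' : List (Fin n × Bool)} (u : BraidWord n)
    (h : stateMatrix l = stateMatrix l') : stateSum l u = stateSum l' u := by
  induction u generalizing l l' with
  | nil => rw [stateSum, stateSum, stateValue, stateValue,
      loops_eq_of_trace ((congrArg _ h).trans (two_pow_loops l').symm)]
  | cons x u ih =>
    rw [stateSum, stateSum, ih (l := l ++ [(x.1, true)]) (l' := l' ++ [(x.1, true)]),
      ih (l := l ++ [(x.1, false)]) (l' := l' ++ [(x.1, false)])] <;>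
    rw [stateMatrix_append, stateMatrix_append, h]

/-- Doubling the matrix doubles every trace, which means one more circle in every state; the
colouring weight `2` of a circle thus translates into `circleValue`. -/
lemma stateSum_of_two_nsmul {n : ℕ} {l l' : List (Fin n × Bool)} (u : BraidWord n)
    (h : stateMatrix l = 2 • stateMatrix l') : stateSum l u = circleValue * stateSum l' u := by
  induction u generalizing l l' with
  | nil =>
    have h1 : loops l = loops l' + 1 := by
      apply loops_eq_of_trace
      rw [h, Matrix.trace_smul, ← two_pow_loops, pow_succ, smul_eq_mul, mul_comm]
    rw [stateSum, stateSum, stateValue, stateValue, h1, ← pow_succ', Nat.add_sub_cancel,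
      Nat.sub_add_cancel (loops_pos l')]
  | cons x u ih =>
    rw [stateSum, stateSum, ih (l := l ++ [(x.1, true)]) (l' := l' ++ [(x.1, true)]),
      ih (l := l ++ [(x.1, false)]) (l' := l' ++ [(x.1, false)])]
    · ring
    all_goals rw [stateMatrix_append, stateMatrix_append, h, smul_mul_assoc]

/-- The coefficient of the cup-cap diagram in a twist region, as a polynomial in `t`. -/
noncomputable def twistPoly (a : ℕ) : ℤ[X] := ∑ j ∈ Finset.range a, (-X) ^ j

lemma twistPoly_succ (a : ℕ) : twistPoly (a + 1) = 1 - X * twistPoly a := by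
  rw [twistPoly, geom_sum_succ, twistPoly]; ring

lemma inQuarterPowers_X : inQuarterPowers X = LaurentPolynomial.T 4 := by
  simp [inQuarterPowers]

/-- This is `σ_i ^ a = A ^ a (1 + t ^ (1/2) P_a e_i)`. Multiplying by one more crossing and using
`e_i ^ 2 = δ e_i`, `t ^ (1/2) δ = -(1 + t)` gives the recursion `P_{a+1} = 1 - t P_a`. -/
lemma stateSum_replicate (l : List (Fin 2 × Bool)) (i : Fin 2) (a : ℕ) (u : BraidWord 2) :
    stateSum l (List.replicate a (i, true) ++ u) = LaurentPolynomial.T (-a) * (stateSum l u +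
      LaurentPolynomial.T 2 * inQuarterPowers (twistPoly a) * stateSum (l ++ [(i, false)]) u) := by
  induction a generalizing l with
  | zero => simp [twistPoly, inQuarterPowers]
  | succ a ih =>
    rw [List.replicate_succ, List.cons_append, stateSum, ih, ih,
      stateSum_congr (l := l ++ [(i, true)]) (l' := l) u,
      stateSum_congr (l := l ++ [(i, true)] ++ [(i, false)]) (l' := l ++ [(i, false)]) u,
      stateSum_of_two_nsmul (l := l ++ [(i, false)] ++ [(i, false)]) (l' := l ++ [(i, false)]) u]
    · have h1 : (LaurentPolynomial.T (-((a + 1 : ℕ) : ℤ)) : LaurentPolynomial ℤ) =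
          LaurentPolynomial.T (-1) * LaurentPolynomial.T (-a) := by
        rw [← LaurentPolynomial.T_add]; congr 1; push_cast; ring
      have h2 : (LaurentPolynomial.T 1 : LaurentPolynomial ℤ) =
          LaurentPolynomial.T (-1) * LaurentPolynomial.T 2 := by
        rw [← LaurentPolynomial.T_add]; congr 1
      have h3 : (LaurentPolynomial.T 2 : LaurentPolynomial ℤ) * LaurentPolynomial.T 2 =
          LaurentPolynomial.T 4 := by
        rw [← LaurentPolynomial.T_add]; congr 1
      have h4 : (LaurentPolynomial.T 2 : LaurentPolynomial ℤ) * LaurentPolynomial.T (-2) = 1 := by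
        rw [← LaurentPolynomial.T_add, ← LaurentPolynomial.T_zero]; congr 1
      have h5 : inQuarterPowers (twistPoly (a + 1)) =
          1 - LaurentPolynomial.T 4 * inQuarterPowers (twistPoly a) := by
        rw [twistPoly_succ]; simp [inQuarterPowers]
      rw [h1, h5, ← h3, circleValue]
      simp only [if_true, Bool.false_eq_true, if_false, h2]
      generalize inQuarterPowers (twistPoly a) = p
      linear_combination (-LaurentPolynomial.T (-1) * LaurentPolynomial.T (-a) *
        LaurentPolynomial.T 2 * p * stateSum (l ++ [(i, false)]) u) * h4
    · rw [stateMatrix_append, stateMatrix_append, mul_assoc, stateMatrix_singleton,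
        cupCap_mul_self, mul_smul_comm]
    · simp [stateMatrix, smoothing_vertical]
    · simp [stateMatrix, smoothing_vertical]

/-! ### The Jones polynomial of the four-block word -/

/-- The normalized Jones polynomial of the closure of `σ₁ ^ a σ₂ ^ b σ₁ ^ c σ₂ ^ d`. -/
noncomputable def rankTwoPoly (a b c d : ℕ) : ℤ[X] :=
  eps (a + b + c + d) * ((1 + X) ^ 2
    - X * (1 + X) * (twistPoly a + twistPoly b + twistPoly c + twistPoly d)
    + X * (1 + X) ^ 2 * (twistPoly a * twistPoly c + twistPoly b * twistPoly d)
    + X ^ 2 * (twistPoly a + twistPoly c) * (twistPoly b + twistPoly d)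
    - X ^ 2 * (1 + X) * (twistPoly a * twistPoly c * (twistPoly b + twistPoly d)
      + twistPoly b * twistPoly d * (twistPoly a + twistPoly c))
    + X ^ 3 * (twistPoly a * twistPoly b * twistPoly c * twistPoly d))

lemma stateMatrix_cons {n : ℕ} (x : Fin n × Bool) (l : List (Fin n × Bool)) :
    stateMatrix (x :: l) = smoothing x * stateMatrix l := by
  simp [stateMatrix]

lemma stateValue_nil : stateValue ([] : List (Fin 2 × Bool)) = circleValue ^ 2 :=
  stateValue_of_trace (by simp [stateMatrix])

lemma stateValue_singleton (i : Fin 2) : stateValue [(i, false)] = circleValue :=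
  (stateValue_of_trace (k := 1) (by rw [stateMatrix_singleton, trace_cupCap]; rfl)).trans (pow_one _)

lemma stateValue_pair : stateValue [((0 : Fin 2), false), (1, false)] = 1 :=
  stateValue_of_trace (k := 0)
    (by rw [stateMatrix_cons, stateMatrix_singleton, trace_cupCap_mul_cupCap]; rfl)

lemma stateValue_rotate {n : ℕ} (l l' : List (Fin n × Bool)) :
    stateValue (l ++ l') = stateValue (l' ++ l) := by
  rw [stateValue, stateValue, loops_eq_of_trace (l := l ++ l') (k := loops (l' ++ l))]
  rw [stateMatrix_append, Matrix.trace_mul_comm, ← stateMatrix_append, two_pow_loops]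

lemma stateValue_congr {n : ℕ} {l l' : List (Fin n × Bool)}
    (h : stateMatrix l = stateMatrix l') : stateValue l = stateValue l' :=
  stateSum_congr [] h

lemma stateValue_of_two_nsmul {n : ℕ} {l l' : List (Fin n × Bool)}
    (h : stateMatrix l = 2 • stateMatrix l') : stateValue l = circleValue * stateValue l' :=
  stateSum_of_two_nsmul [] h

lemma stateValue_double (i : Fin 2) (l : List (Fin 2 × Bool)) :
    stateValue ((i, false) :: (i, false) :: l) = circleValue * stateValue ((i, false) :: l) :=
  stateValue_of_two_nsmul (by
    rw [stateMatrix_cons, stateMatrix_cons, ← mul_assoc, cupCap_mul_self,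
      smul_mul_assoc])

lemma stateValue_zigzag (l : List (Fin 2 × Bool)) :
    stateValue ((0, false) :: (1, false) :: (0, false) :: l) = stateValue ((0, false) :: l) :=
  stateValue_congr (by
    simp only [stateMatrix_cons]
    rw [← mul_assoc (smoothing (1, false)), ← mul_assoc, cupCap_mul_cupCap_mul_cupCap])

/-- Each twist region contributes either the identity or a cup-cap, giving sixteen words in `e_0,
e_1`; doubling, zigzag and rotation reduce every word to a power of `δ`. -/
lemma jonesStar_rankTwoWord (a b c d : ℕ) :
    jonesStar (rankTwoWord a b c d) = inQuarterPowers (rankTwoPoly a b c d) := by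
  have hw : writhe (rankTwoWord a b c d) = (a + b + c + d : ℕ) := by
    simp [writhe, rankTwoWord, add_assoc]
  have hT : ∀ m n : ℤ, (LaurentPolynomial.T (m + n) : LaurentPolynomial ℤ) =
    LaurentPolynomial.T m * LaurentPolynomial.T n := LaurentPolynomial.T_add
  have h3 : (LaurentPolynomial.T 4 : LaurentPolynomial ℤ) = LaurentPolynomial.T 2 ^ 2 := by
    rw [sq, ← hT]; congr 1
  have h4 : (LaurentPolynomial.T 2 : LaurentPolynomial ℤ) * LaurentPolynomial.T (-2) = 1 := by
    rw [← hT, ← LaurentPolynomial.T_zero]; congr 1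
  have hδ : LaurentPolynomial.T 2 * circleValue = -(1 + LaurentPolynomial.T 2 ^ 2) := by
    rw [circleValue]; linear_combination -h4
  have hsign : (((a + b + c + d : ℕ) : ℤ).negOnePow : ℤ) = (-1) ^ (a + b + c + d) := by
    rw [Int.negOnePow_def, zpow_natCast]; simp
  -- The final `[]` lets `stateSum_replicate` apply to all four regions.
  have hword : rankTwoWord a b c d = List.replicate a (0, true) ++ (List.replicate b (1, true) ++
    (List.replicate c (0, true) ++ (List.replicate d (1, true) ++ []))) := by
    simp [rankTwoWord]
  -- The normalization, the writhe factor and the four factors `A ^ n` combine to the single power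
  -- `t`, which provides the two half powers absorbed by `δ ^ 2`.
  have hpow : (LaurentPolynomial.T (-2 * (((a + b + c + d : ℕ) : ℤ) - 2)) : LaurentPolynomial ℤ) *
      LaurentPolynomial.T (3 * ((a + b + c + d : ℕ) : ℤ)) * LaurentPolynomial.T (-a) *
      LaurentPolynomial.T (-b) * LaurentPolynomial.T (-c) * LaurentPolynomial.T (-d) =
      LaurentPolynomial.T 2 ^ 2 := by
    rw [← h3]
    simp only [← hT]; congr 1; push_cast; ring
  have e00 : stateValue [((0 : Fin 2), false), (0, false)] = circleValue ^ 2 := by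
    rw [stateValue_double, stateValue_singleton, sq]
  have e11 : stateValue [((1 : Fin 2), false), (1, false)] = circleValue ^ 2 := by
    rw [stateValue_double, stateValue_singleton, sq]
  have e10 : stateValue [((1 : Fin 2), false), (0, false)] = 1 := by
    rw [← stateValue_pair]; exact stateValue_rotate [_] [_]
  have e010 : stateValue [((0 : Fin 2), false), (1, false), (0, false)] = circleValue := by
    rw [stateValue_zigzag, stateValue_singleton]
  have e101 : stateValue [((1 : Fin 2), false), (0, false), (1, false)] = circleValue := by
    rw [show [((1 : Fin 2), false), (0, false), (1, false)] = [(1, false), (0, false)] ++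
      [(1, false)] from rfl, stateValue_rotate]
    simp only [List.cons_append, List.nil_append]
    rw [stateValue_double, e10, mul_one]
  have e011 : stateValue [((0 : Fin 2), false), (1, false), (1, false)] = circleValue := by
    rw [show [((0 : Fin 2), false), (1, false), (1, false)] = [(0, false)] ++ [(1, false),
      (1, false)] from rfl, stateValue_rotate]
    simp only [List.cons_append, List.nil_append]
    rw [stateValue_double, e10, mul_one]
  have e001 : stateValue [((0 : Fin 2), false), (0, false), (1, false)] = circleValue := by
    rw [stateValue_double, stateValue_pair, mul_one]
  have e0101 : stateValue [((0 : Fin 2), false), (1, false), (0, false), (1, false)] = 1 := by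
    rw [stateValue_zigzag, stateValue_pair]
  have hright : inQuarterPowers (rankTwoPoly a b c d) = (-1) ^ (a + b + c + d) *
      ((1 + LaurentPolynomial.T 2 ^ 2) ^ 2 - LaurentPolynomial.T 2 ^ 2 * (1 + LaurentPolynomial.T 2 ^ 2)
        * (inQuarterPowers (twistPoly a) + inQuarterPowers (twistPoly b)
          + inQuarterPowers (twistPoly c) + inQuarterPowers (twistPoly d))
      + LaurentPolynomial.T 2 ^ 2 * (1 + LaurentPolynomial.T 2 ^ 2) ^ 2
        * (inQuarterPowers (twistPoly a) * inQuarterPowers (twistPoly c)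
          + inQuarterPowers (twistPoly b) * inQuarterPowers (twistPoly d))
      + (LaurentPolynomial.T 2 ^ 2) ^ 2
        * (inQuarterPowers (twistPoly a) + inQuarterPowers (twistPoly c))
        * (inQuarterPowers (twistPoly b) + inQuarterPowers (twistPoly d))
      - (LaurentPolynomial.T 2 ^ 2) ^ 2 * (1 + LaurentPolynomial.T 2 ^ 2)
        * (inQuarterPowers (twistPoly a) * inQuarterPowers (twistPoly c)
            * (inQuarterPowers (twistPoly b) + inQuarterPowers (twistPoly d))
          + inQuarterPowers (twistPoly b) * inQuarterPowers (twistPoly d)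
            * (inQuarterPowers (twistPoly a) + inQuarterPowers (twistPoly c)))
      + (LaurentPolynomial.T 2 ^ 2) ^ 3
        * (inQuarterPowers (twistPoly a) * inQuarterPowers (twistPoly b)
          * inQuarterPowers (twistPoly c) * inQuarterPowers (twistPoly d))) := by
    rw [← h3, ← inQuarterPowers_X]
    simp only [inQuarterPowers, rankTwoPoly, eps, map_mul, map_add, map_sub, map_pow, map_neg,
      map_one]
  rw [jonesStar, jones, hw, hright, bracket_eq_stateSum, hword, hsign, zsmul_eq_mul]
  simp only [stateSum_replicate]
  simp only [List.nil_append, List.cons_append, stateSum, stateValue_nil, stateValue_singleton,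
    stateValue_pair, e00, e11, e10, e010, e101, e011, e001, e0101]
  generalize inQuarterPowers (twistPoly a) = p
  generalize inQuarterPowers (twistPoly b) = q
  generalize inQuarterPowers (twistPoly c) = r
  generalize inQuarterPowers (twistPoly d) = s
  push_cast
  push_cast at hpow
  generalize (LaurentPolynomial.T (-2 * ((a : ℤ) + b + c + d - 2)) : LaurentPolynomial ℤ) = t1 at *
  generalize (LaurentPolynomial.T (3 * ((a : ℤ) + b + c + d)) : LaurentPolynomial ℤ) = t2 at *
  generalize (LaurentPolynomial.T (-(a : ℤ)) : LaurentPolynomial ℤ) = t3 at *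
  generalize (LaurentPolynomial.T (-(b : ℤ)) : LaurentPolynomial ℤ) = t4 at *
  generalize (LaurentPolynomial.T (-(c : ℤ)) : LaurentPolynomial ℤ) = t5 at *
  generalize (LaurentPolynomial.T (-(d : ℤ)) : LaurentPolynomial ℤ) = t6 at *
  generalize (LaurentPolynomial.T 2 : LaurentPolynomial ℤ) = y at *
  generalize circleValue = δ at *
  -- Each `δ` is paired with a factor `y = t ^ (1/2)`, so that only integral powers of `t` remain
  -- after `hδ`.
  trans (-1) ^ (a + b + c + d) * ((y * δ) ^ 2 + y ^ 2 * (y * δ) * (p + q + r + s)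
    + y ^ 2 * (y * δ) ^ 2 * (p * r + q * s) + (y ^ 2) ^ 2 * (p + r) * (q + s)
    + (y ^ 2) ^ 2 * (y * δ) * (p * r * (q + s) + q * s * (p + r)) + (y ^ 2) ^ 3 * (p * q * r * s))
  · linear_combination (exp := 1) (-1) ^ (a + b + c + d) * (δ ^ 2 + y * δ * (p + q + r + s)
      + y ^ 2 * δ ^ 2 * (p * r + q * s) + y ^ 2 * (p + r) * (q + s)
      + y ^ 3 * δ * (p * r * (q + s) + q * s * (p + r)) + y ^ 4 * (p * q * r * s)) * hpow
  · rw [hδ]; ring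

/-! ### Closed forms of `A`, `L`, `R` and the twist polynomials -/

lemma eps_eq_C (k : ℕ) : eps k = C ((-1) ^ k) := by simp [eps]

lemma altPoly_mul (n : ℕ) : altPoly n * (1 + X) = X ^ n - (-1) ^ n := by
  have h := (Commute.all (X : ℤ[X]) (-1)).geom_sum₂_mul n
  rw [sub_neg_eq_add, add_comm X] at h
  rw [← h, altPoly, ← Finset.sum_range_reflect]
  congr 1
  refine Finset.sum_congr rfl fun j hj => ?_
  have := Finset.mem_range.1 hj
  rw [eps, mul_comm, show n - 1 - (n - 1 - j) = j by omega]

lemma twistPoly_mul (n : ℕ) : twistPoly n * (1 + X) = 1 - (-X) ^ n := by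
  have h := geom_sum_mul (-X : ℤ[X]) n
  rw [twistPoly]
  linear_combination -h

lemma altPoly_coeff (n j : ℕ) : (altPoly n).coeff j = if j < n then (-1) ^ (n - 1 - j) else 0 := by
  have : altPoly n = ∑ i ∈ Finset.range n, C ((-1) ^ (n - 1 - i)) * X ^ i := by
    rw [altPoly, ← Finset.sum_range_reflect]
    refine Finset.sum_congr rfl fun i hi => ?_
    have := Finset.mem_range.1 hi
    rw [eps_eq_C, show n - 1 - (n - 1 - i) = i by omega]
  simp only [this, finsetSum_coeff, coeff_C_mul, coeff_X_pow]
  simp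

lemma natDegree_altPoly_le (n : ℕ) : (altPoly n).natDegree ≤ n - 1 :=
  natDegree_le_iff_coeff_eq_zero.2 fun j hj => by rw [altPoly_coeff, if_neg (by omega)]

lemma natDegree_altPoly_succ_le (n : ℕ) : (altPoly (n + 1)).natDegree ≤ n :=
  natDegree_altPoly_le _

lemma altPoly_coeff_top (n : ℕ) : (altPoly (n + 1)).coeff n = 1 := by
  simp [altPoly_coeff]

lemma altPoly_eval (n : ℕ) : (altPoly (n + 1)).eval (-1) = (-1) ^ n * (n + 1) := by
  simp only [altPoly, eval_finsetSum, eval_mul, eval_pow, eval_X, eps, eval_neg, eval_one]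
  rw [Finset.sum_congr rfl (g := fun _ => (-1 : ℤ) ^ n)]
  · simp [mul_comm]
  · intro j hj
    have := Finset.mem_range.1 hj
    rw [← pow_add]; congr 1; omega

/-- Induction on `L(n) = (n + 1) t ^ n - L(n - 1)`. The argument is shifted to `n - 1` so that `n =
0` is the empty sum. -/
lemma incPoly_mul (n : ℕ) : incPoly ((n : ℤ) - 1) * (1 + X) ^ 2 =
    (n : ℤ[X]) * X ^ (n + 1) + ((n : ℤ[X]) + 1) * X ^ n - (-1) ^ n := by
  have hrec : ∀ n : ℕ, incPoly (((n + 1 : ℕ) : ℤ) - 1) =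
      ((n : ℤ[X]) + 1) * X ^ n - incPoly ((n : ℤ) - 1) := by
    intro n
    rw [incPoly, incPoly, show (((n + 1 : ℕ) : ℤ) - 1 + 1).toNat = n + 1 by omega,
      show ((n : ℤ) - 1 + 1).toNat = n by omega, Finset.sum_range_succ', add_comm,
      sub_eq_add_neg (((n : ℤ[X]) + 1) * X ^ n), ← Finset.sum_neg_distrib]
    congr 1
    · simp [eps, add_comm]
    · refine Finset.sum_congr rfl fun j hj => ?_
      have := Finset.mem_range.1 hj
      rw [show (((n + 1 : ℕ) : ℤ) - 1 - (j + 1 : ℕ)).toNat = ((n : ℤ) - 1 - j).toNat by omega,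
        eps, eps, pow_succ]
      push_cast
      simp only [C_add, C_sub, C_1]
      ring
  induction n with
  | zero => simp [incPoly]
  | succ n ih =>
    rw [hrec, sub_mul, ih]
    push_cast
    ring

/-- Induction on `R(n) = t R(n - 1) + (-1) ^ n (n + 1)`. -/
lemma decPoly_mul (n : ℕ) : decPoly ((n : ℤ) - 1) * (1 + X) ^ 2 =
    X ^ (n + 1) - (-1) ^ n * (((n : ℤ[X]) + 1) * X + (n : ℤ[X])) := by
  have hrec : ∀ n : ℕ, decPoly (((n + 1 : ℕ) : ℤ) - 1) =
      X * decPoly ((n : ℤ) - 1) + (-1) ^ n * ((n : ℤ[X]) + 1) := by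
    intro n
    rw [decPoly, decPoly, show (((n + 1 : ℕ) : ℤ) - 1 + 1).toNat = n + 1 by omega,
      show ((n : ℤ) - 1 + 1).toNat = n by omega, Finset.sum_range_succ, Finset.mul_sum]
    congr 1
    · refine Finset.sum_congr rfl fun j hj => ?_
      have := Finset.mem_range.1 hj
      rw [show (((n + 1 : ℕ) : ℤ) - 1 - j).toNat = ((n : ℤ) - 1 - j).toNat + 1 by omega]
      ring
    · simp [eps]
  induction n with
  | zero => simp [decPoly]
  | succ n ih =>
    rw [hrec, add_mul, mul_assoc, ih]
    push_cast
    ring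

lemma natDegree_incPoly_le (n : ℕ) : (incPoly ((n : ℤ) - 1)).natDegree ≤ n - 1 := by
  refine natDegree_sum_le_of_forall_le _ _ fun j hj => ?_
  rw [eps_eq_C, ← C_mul]
  exact (natDegree_C_mul_X_pow_le _ _).trans (by omega)

/-- Covers `n = m = 0`, where the sum is empty and a bound on `natDegree` would not exclude a
constant term. -/
lemma decPoly_coeff_of_le {n m : ℕ} (h : n ≤ m) : (decPoly ((n : ℤ) - 1)).coeff m = 0 := by
  rw [decPoly, finsetSum_coeff]
  refine Finset.sum_eq_zero fun j hj => ?_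
  have := Finset.mem_range.1 hj
  rw [eps_eq_C, ← C_mul, coeff_C_mul, coeff_X_pow, if_neg (by omega), mul_zero]

lemma natDegree_decPoly_le (n : ℕ) : (decPoly ((n : ℤ) - 1)).natDegree ≤ n - 1 := by
  refine natDegree_sum_le_of_forall_le _ _ fun j hj => ?_
  rw [eps_eq_C, ← C_mul]
  exact (natDegree_C_mul_X_pow_le _ _).trans (by omega)

/-! ### Coefficients of the fourfold product -/

/-- The coefficients of `altPoly a * q` below degree `a`. -/
lemma altPoly_mul_coeff (q : ℤ[X]) {a j : ℕ} (h : j < a) : (altPoly a * q).coeff j =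
    (-1) ^ (a - 1 - j) * ∑ i ∈ Finset.range (j + 1), q.coeff i * (-1) ^ i := by
  rw [mul_comm, coeff_mul, Finset.Nat.sum_antidiagonal_eq_sum_range_succ
    (fun i k => q.coeff i * (altPoly a).coeff k), Finset.mul_sum]
  refine Finset.sum_congr rfl fun i hi => ?_
  have := Finset.mem_range.1 hi
  rw [altPoly_coeff, if_pos (by omega), show a - 1 - (j - i) = (a - 1 - j) + i by omega, pow_add]
  ring

/-- Once `j` reaches the degree of `q`, the alternating partial sum contains all coefficients and is
`q(-1)`. -/
lemma altPoly_mul_coeff_of_natDegree_le {q : ℤ[X]} {m a j : ℕ} (hq : q.natDegree ≤ m) (hm : m ≤ j)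
    (h : j < a) : (altPoly a * q).coeff j = (-1) ^ (a - 1 - j) * q.eval (-1) := by
  rw [altPoly_mul_coeff q h, eval_eq_sum_range' (n := j + 1) (by omega)]

lemma altProd_eq (a b c d : ℕ) :
    altProd a b c d = altPoly a * (altPoly b * altPoly c * altPoly d) := by
  rw [altProd]; ring

lemma natDegree_triple_le (b c d : ℕ) :
    (altPoly (b + 1) * altPoly (c + 1) * altPoly (d + 1)).natDegree ≤ b + c + d :=
  natDegree_mul_le_of_le (natDegree_mul_le_of_le (natDegree_altPoly_succ_le _) (natDegree_altPoly_succ_le _))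
    (natDegree_altPoly_succ_le _)

lemma triple_coeff_top (b c d : ℕ) :
    (altPoly (b + 1) * altPoly (c + 1) * altPoly (d + 1)).coeff (b + c + d) = 1 := by
  rw [coeff_mul_add_eq_of_natDegree_le (natDegree_mul_le_of_le
    (natDegree_altPoly_succ_le _) (natDegree_altPoly_succ_le _)) (natDegree_altPoly_succ_le _),
    coeff_mul_add_eq_of_natDegree_le (natDegree_altPoly_succ_le _) (natDegree_altPoly_succ_le _)]
  simp [altPoly_coeff_top]

lemma triple_eval (b c d : ℕ) :
    (altPoly (b + 1) * altPoly (c + 1) * altPoly (d + 1)).eval (-1) =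
      (-1) ^ (b + c + d) * ((b + 1) * (c + 1) * (d + 1)) := by
  rw [eval_mul, eval_mul, altPoly_eval, altPoly_eval, altPoly_eval]
  ring

lemma altProd_coeff_top (a b c d : ℕ) :
    (altProd (a + 1) (b + 1) (c + 1) (d + 1)).coeff (a + (b + c + d)) = 1 := by
  rw [altProd_eq, coeff_mul_add_eq_of_natDegree_le (natDegree_altPoly_succ_le _) (natDegree_triple_le b c d),
    triple_coeff_top, altPoly_coeff_top, one_mul]

lemma altProd_coeff_of_lt {a b c d n : ℕ} (h : a + (b + c + d) < n) :
    (altProd (a + 1) (b + 1) (c + 1) (d + 1)).coeff n = 0 := by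
  rw [altProd_eq]
  exact coeff_eq_zero_of_natDegree_lt ((natDegree_mul_le_of_le (natDegree_altPoly_succ_le _)
    (natDegree_triple_le b c d)).trans_lt h)

lemma altProd_coeff_middle {a b c d n : ℕ} (h : b + c + d ≤ n) (hn : n ≤ a) :
    (altProd (a + 1) (b + 1) (c + 1) (d + 1)).coeff n =
      (-1) ^ (a - n) * ((-1) ^ (b + c + d) * ((b + 1) * (c + 1) * (d + 1))) := by
  rw [altProd_eq, altPoly_mul_coeff_of_natDegree_le (natDegree_triple_le b c d) h (by omega),
    triple_eval, Nat.add_sub_cancel]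

/-- Just below the middle band the partial sum lacks only the leading term of the monic triple
product, so `bcd` becomes `bcd - 1` in absolute value. This is the leading coefficient of `f`, up to
sign. -/
lemma altProd_coeff_low {a b c d n : ℕ} (h : b + c + d = n + 1) (hn : n ≤ a) :
    (altProd (a + 1) (b + 1) (c + 1) (d + 1)).coeff n =
      (-1) ^ (a - n) * ((-1) ^ (n + 1) * ((b + 1) * (c + 1) * (d + 1) - 1)) := by
  have h1 := triple_eval b c d
  rw [eval_eq_sum_range' (n := n + 1 + 1) (by have := natDegree_triple_le b c d; omega),
    Finset.sum_range_succ, ← h, triple_coeff_top, h] at h1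
  rw [altProd_eq, altPoly_mul_coeff _ (by omega), Nat.add_sub_cancel]
  linear_combination (-1) ^ (a - n) * h1

lemma lowPart_coeff (a b c d n : ℕ) : (lowPart a b c d).coeff n =
    if n < b + c + d - 3 then (altProd a b c d).coeff n else 0 := by
  simp [lowPart, finsetSum_coeff, coeff_X_pow]

lemma highPart_coeff (a b c d n : ℕ) : (highPart a b c d).coeff n =
    if n < b + c + d - 3 then (altProd a b c d).coeff (a + n) else 0 := by
  simp [highPart, finsetSum_coeff, coeff_X_pow]

lemma natDegree_lowPart_le (a b c d : ℕ) : (lowPart a b c d).natDegree ≤ b + c + d - 4 :=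
  natDegree_sum_le_of_forall_le _ _ fun j hj =>
    (natDegree_C_mul_X_pow_le _ _).trans (by have := Finset.mem_range.1 hj; omega)

lemma natDegree_highPart_le (a b c d : ℕ) : (highPart a b c d).natDegree ≤ b + c + d - 4 :=
  natDegree_sum_le_of_forall_le _ _ fun j hj =>
    (natDegree_C_mul_X_pow_le _ _).trans (by have := Finset.mem_range.1 hj; omega)

lemma parts_eq_zero (a : ℕ) : lowPart a 1 1 1 = 0 ∧ highPart a 1 1 1 = 0 := by
  simp [lowPart, highPart]

lemma lowPart_degree {a b c d : ℕ} (ha : b + c + d ≤ a) (h : b + c + d ≠ 0) :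
    (lowPart (a + 1) (b + 1) (c + 1) (d + 1)).degree =
      ((b + 1 + (c + 1) + (d + 1) - 4 : ℕ) : WithBot ℕ) := by
  obtain ⟨n, hn⟩ := Nat.exists_eq_succ_of_ne_zero h
  refine degree_eq_of_le_of_coeff_ne_zero
    (degree_le_of_natDegree_le (natDegree_lowPart_le _ _ _ _)) ?_
  rw [lowPart_coeff, if_pos (by omega), show b + 1 + (c + 1) + (d + 1) - 4 = n by omega,
    altProd_coeff_low hn (by omega)]
  refine mul_ne_zero (by simp) (mul_ne_zero (by simp) ?_)
  have h1 : (b : ℤ) + c + d = n + 1 := by exact_mod_cast hn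
  -- With shifted exponents, the factor `(b + 1)(c + 1)(d + 1) - 1` is `b + c + d` plus these
  -- products, hence positive.
  have : (0 : ℤ) ≤ b * c + b * d + c * d + b * c * d := by positivity
  have : (0 : ℤ) ≤ n := by positivity
  apply ne_of_gt
  linarith

lemma highPart_coeff_top {a b c d : ℕ} (h : b + c + d ≠ 0) :
    (highPart (a + 1) (b + 1) (c + 1) (d + 1)).coeff (b + c + d - 1) = 1 := by
  rw [highPart_coeff, if_pos (by omega),
    show a + 1 + (b + c + d - 1) = a + (b + c + d) by omega, altProd_coeff_top]

lemma highPart_degree {a b c d : ℕ} (h : b + c + d ≠ 0) :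
    (highPart (a + 1) (b + 1) (c + 1) (d + 1)).degree =
      ((b + 1 + (c + 1) + (d + 1) - 4 : ℕ) : WithBot ℕ) := by
  refine degree_eq_of_le_of_coeff_ne_zero
    (degree_le_of_natDegree_le (natDegree_highPart_le _ _ _ _)) ?_
  rw [show b + 1 + (c + 1) + (d + 1) - 4 = b + c + d - 1 by omega, highPart_coeff_top h]
  exact one_ne_zero

lemma altProd_decomposition {a b c d : ℕ} (ha : b + 1 + (c + 1) + (d + 1) ≤ a + 1) :
    altProd (a + 1) (b + 1) (c + 1) (d + 1) = lowPart (a + 1) (b + 1) (c + 1) (d + 1)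
      + eps (3 + (b + 1 + (c + 1) + (d + 1))) * (((b + 1) * (c + 1) * (d + 1) : ℕ) : ℤ[X])
        * X ^ (b + 1 + (c + 1) + (d + 1) - 3) * altPoly (a + 1 + 3 - (b + 1 + (c + 1) + (d + 1)))
      + X ^ (a + 1) * highPart (a + 1) (b + 1) (c + 1) (d + 1) := by
  ext n
  rw [coeff_add, coeff_add, eps_eq_C, ← C_eq_natCast, ← C_mul, mul_assoc, coeff_C_mul,
    coeff_X_pow_mul', coeff_X_pow_mul', lowPart_coeff, highPart_coeff, altPoly_coeff]
  have hm : b + 1 + (c + 1) + (d + 1) - 3 = b + c + d := by omega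
  rw [hm]
  rcases lt_or_ge n (b + c + d) with h1 | h1
  · rw [if_pos h1, if_neg (by omega), if_neg (by omega)]; simp
  rw [if_neg (by omega), if_pos h1]
  rcases lt_or_ge n (a + 1) with h2 | h2
  · rw [if_pos (by omega), if_neg (by omega), altProd_coeff_middle h1 (by omega),
      show a + 1 + 3 - (b + 1 + (c + 1) + (d + 1)) - 1 - (n - (b + c + d)) = a - n by omega,
      show 3 + (b + 1 + (c + 1) + (d + 1)) = b + c + d + 2 * 3 by omega, pow_add _ _ (2 * 3)]
    push_cast
    simp
    ring
  · rw [if_neg (by omega), if_pos h2]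
    rcases lt_or_ge (n - (a + 1)) (b + c + d) with h3 | h3
    · rw [if_pos h3, show a + 1 + (n - (a + 1)) = n by omega]; simp
    · rw [if_neg (by omega), altProd_coeff_of_lt (by omega)]; simp

/-! ### Markov moves to torus links -/

lemma toBraid_append {n : ℕ} (u v : BraidWord n) :
    (u ++ v).toBraid = u.toBraid * v.toBraid := by
  rw [BraidWord.toBraid, ← FreeGroup.mul_mk, map_mul]; rfl

lemma toBraid_artin : BraidWord.toBraid ([(0, true), (1, true), (0, true)] : BraidWord 2) =
    BraidWord.toBraid [(1, true), (0, true), (1, true)] := by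
  have h : PresentedGroup.mk (artinRelators 2)
      ((FreeGroup.of 0 * FreeGroup.of 1 * FreeGroup.of 0) *
        (FreeGroup.of 1 * FreeGroup.of 0 * FreeGroup.of 1)⁻¹) = 1 :=
    PresentedGroup.one_of_mem (Or.inr ⟨0, 1, rfl, rfl⟩)
  rw [map_mul, map_inv, mul_inv_eq_one] at h
  exact h

/-- Artin's relation says `σ₂ (σ₁σ₂) = (σ₁σ₂) σ₁`; iterating it carries a power of `σ₂` through
`σ₁σ₂` into a power of `σ₁`, leaving a single `σ₂` to destabilize. -/
lemma toBraid_slide_left (b : ℕ) :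
    BraidWord.toBraid (List.replicate b ((1 : Fin 2), true) ++ [(0, true), (1, true)]) =
      BraidWord.toBraid ([(0, true), (1, true)] ++ List.replicate b (0, true)) := by
  induction b with
  | zero => rfl
  | succ b ih =>
    have e1 : List.replicate (b + 1) ((1 : Fin 2), true) ++ [(0, true), (1, true)] =
      [(1, true)] ++ (List.replicate b ((1 : Fin 2), true) ++ [(0, true), (1, true)]) := rfl
    have e2 : [((0 : Fin 2), true), (1, true)] ++ List.replicate (b + 1) (0, true) =
      [(0, true), (1, true), (0, true)] ++ List.replicate b (0, true) := rfl
    rw [e1, e2, toBraid_append, ih, toBraid_append [(0, true), (1, true), (0, true)],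
      toBraid_artin, ← toBraid_append, ← toBraid_append]
    rfl

lemma toBraid_slide_right (d : ℕ) :
    BraidWord.toBraid ([((1 : Fin 2), true), (0, true)] ++ List.replicate d (1, true)) =
      BraidWord.toBraid (List.replicate d (0, true) ++ [((1 : Fin 2), true), (0, true)]) := by
  induction d with
  | zero => rfl
  | succ d ih =>
    have e1 : [((1 : Fin 2), true), (0, true)] ++ List.replicate (d + 1) (1, true) =
      ([((1 : Fin 2), true), (0, true)] ++ List.replicate d (1, true)) ++ [(1, true)] := by
      rw [List.replicate_succ', List.append_assoc]
    have e2 : List.replicate (d + 1) (0, true) ++ [((1 : Fin 2), true), (0, true)] =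
      List.replicate d (0, true) ++ [(0, true), (1, true), (0, true)] := by
      rw [List.replicate_succ', List.append_assoc]; rfl
    rw [e1, e2, toBraid_append, ih, ← toBraid_append, List.append_assoc, toBraid_append,
      toBraid_append _ [(0, true), (1, true), (0, true)], toBraid_artin]
    rfl

lemma stabilize_twoStrandTorusWord (s : ℕ) :
    (twoStrandTorusWord s).stabilize true =
      (List.replicate s (0, true) ++ [(1, true)] : BraidWord 2) := by
  rw [BraidWord.stabilize, twoStrandTorusWord, List.map_replicate]; rfl

/-- The closure of `σ₁ ^ m σ₂ σ₁ ^ n` is the torus link `T(2, m + n)`. -/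
lemma sameClosure_single (m n : ℕ) :
    SameClosure (List.replicate m (0, true) ++ [(1, true)] ++ List.replicate n (0, true) : BraidWord 2)
      (twoStrandTorusWord (n + m)) := by
  refine (SameClosure.conj _ _).trans (SameClosure.symm ?_)
  rw [← List.append_assoc, ← List.replicate_add, ← stabilize_twoStrandTorusWord]
  exact SameClosure.stab _ _

lemma sameClosure_of_last_eq_one (a b : ℕ) :
    SameClosure (rankTwoWord a b 1 1) (twoStrandTorusWord (b + (a + 1))) := by
  refine SameClosure.trans (SameClosure.braid ?_) (sameClosure_single (a + 1) b)
  rw [rankTwoWord, List.append_assoc, List.append_assoc, toBraid_append]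
  change _ * BraidWord.toBraid (List.replicate b ((1 : Fin 2), true) ++ [(0, true), (1, true)]) = _
  rw [toBraid_slide_left, ← toBraid_append, List.replicate_succ']
  simp

lemma sameClosure_of_first_eq_one (a d : ℕ) :
    SameClosure (rankTwoWord a 1 1 d) (twoStrandTorusWord (1 + (a + d))) := by
  refine SameClosure.trans (SameClosure.braid ?_) (sameClosure_single (a + d) 1)
  rw [rankTwoWord, List.append_assoc, List.append_assoc, toBraid_append]
  change _ * BraidWord.toBraid ([((1 : Fin 2), true), (0, true)] ++ List.replicate d (1, true)) = _
  rw [toBraid_slide_right, ← toBraid_append, ← List.append_assoc,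
    ← List.replicate_add]
  simp

/-! ### The block decomposition -/

set_option maxHeartbeats 4000000 in
/-- The block decomposition as an identity between rational functions, with `t ^ b` and `(-1) ^ b`
replaced by independent variables. -/
lemma block_identity {K : Type*} [Field K] (x xb xc xd xk eb ec ed ek nb nc nd : K)
    (hx : 1 + x ≠ 0) (hb : eb = 1 ∨ eb = -1) (hc : ec = 1 ∨ ec = -1) (hd : ed = 1 ∨ ed = -1)
    (hk : ek = 1 ∨ ek = -1) (Aa Ab Ac Ad Abc Acd Ak Am Lb Ld Rb Rd Pa Pb Pc Pd f g : K)
    (hAa : Aa = (x ^ 3 * xb * xc * xd * xk + eb * ec * ed * ek) / (1 + x))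
    (hAb : Ab = (x * xb + eb) / (1 + x)) (hAc : Ac = (x * xc + ec) / (1 + x))
    (hAd : Ad = (x * xd + ed) / (1 + x)) (hAbc : Abc = (x ^ 2 * xb * xc - eb * ec) / (1 + x))
    (hAcd : Acd = (x ^ 2 * xc * xd - ec * ed) / (1 + x)) (hAk : Ak = (x * xk + ek) / (1 + x))
    (hAm : Am = (x ^ 3 * xk + ek) / (1 + x))
    (hLb : Lb = (nb * (x * xb) + (nb + 1) * xb - eb) / (1 + x) ^ 2)
    (hLd : Ld = (nd * (x * xd) + (nd + 1) * xd - ed) / (1 + x) ^ 2)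
    (hRb : Rb = (x * xb - eb * ((nb + 1) * x + nb)) / (1 + x) ^ 2)
    (hRd : Rd = (x * xd - ed * ((nd + 1) * x + nd)) / (1 + x) ^ 2)
    (hPa : Pa = (1 + eb * ec * ed * ek * (x ^ 3 * xb * xc * xd * xk)) / (1 + x))
    (hPb : Pb = (1 + eb * (x * xb)) / (1 + x)) (hPc : Pc = (1 + ec * (x * xc)) / (1 + x))
    (hPd : Pd = (1 + ed * (x * xd)) / (1 + x))
    (hfg : Aa * Ab * Ac * Ad = f + eb * ec * ed * ((nb + 1) * (nc + 1) * (nd + 1))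
      * (xb * xc * xd) * Am + x ^ 3 * xb * xc * xd * xk * g) :
    ek * ((1 + x) ^ 2 - x * (1 + x) * (Pa + Pb + Pc + Pd) + x * (1 + x) ^ 2 * (Pa * Pc + Pb * Pd)
        + x ^ 2 * (Pa + Pc) * (Pb + Pd)
        - x ^ 2 * (1 + x) * (Pa * Pc * (Pb + Pd) + Pb * Pd * (Pa + Pc))
        + x ^ 3 * (Pa * Pb * Pc * Pd)) =
      (ek * (1 + x ^ 2) + eb * ed * ek * (x ^ 3 * xb * xd)
        + -(eb * ec * ed * ek) * (x ^ 3 * xc) * Ab * Ad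
        + 2 * -(eb * ed * ek) * x ^ 2 * Ab * Ad
        + -(eb * ek) * x ^ 2 * Lb
        + (nb + 1) * -(eb * ec * ed * ek) * (x ^ 2 * xb) * Acd
        + -(ed * ek) * x ^ 2 * Ld
        + (nd + 1) * -(eb * ec * ed * ek) * (x ^ 2 * xd) * Abc
        + x ^ 3 * f
        + eb * ec * ed * ek * ((nb + 1) * (nc + 1) * (nd + 1)) * (x ^ 3 * xb * xc * xd))
      + x ^ 4 * xb * xc * xd * (-(eb * ec * ed)
        * ((nb + 1) * (nc + 1) * (nd + 1) - (nb + 1) - (nd + 1)) * Ak)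
      + x ^ 5 * xb * xc * xd * xk * (eb * ed * xc + -ed * Ab * Ac + -ec * Ab * Ad + -eb * Ac * Ad
        + ec * ed * Rb + eb * ec * Rd + eb * ec * ed * ((nb + 1) * (nc + 1) * (nd + 1)) + x * g) := by
  -- Only the combination `f + t ^ a g` enters, so eliminating `f` makes `g` cancel as well.
  obtain rfl : f = Aa * Ab * Ac * Ad - eb * ec * ed * ((nb + 1) * (nc + 1) * (nd + 1))
      * (xb * xc * xd) * Am - x ^ 3 * xb * xc * xd * xk * g := by
    linear_combination -hfg
  clear hfg
  subst hAa hAb hAc hAd hAbc hAcd hAk hAm hLb hLd hRb hRd hPa hPb hPc hPd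
  -- The identity uses that the signs square to `1`; with numerical signs it is a plain identity of
  -- rational functions.
  rcases hb with rfl | rfl <;> rcases hc with rfl | rfl <;> rcases hd with rfl | rfl <;>
    rcases hk with rfl | rfl <;> field_simp <;> ring

lemma rankTwoPoly_eq_blocks {a b c d : ℕ} (ha : b + 1 + (c + 1) + (d + 1) ≤ a + 1) :
    rankTwoPoly (a + 1) (b + 1) (c + 1) (d + 1) = blockOne (a + 1) (b + 1) (c + 1) (d + 1)
      + X ^ (b + 1 + (c + 1) + (d + 1) + 1) * gap (a + 1) (b + 1) (c + 1) (d + 1)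
      + X ^ (a + 1 + 2) * blockTwo (a + 1) (b + 1) (c + 1) (d + 1) := by
  have hfg := altProd_decomposition ha
  -- Here `k` is the slack `a - w*` for the unshifted exponents; it removes truncated subtraction
  -- and makes `x ^ a` a product of the independent variables.
  obtain ⟨k, rfl⟩ : ∃ k, a = b + c + d + k + 2 := ⟨a - (b + c + d + 2), by omega⟩
  have e1 : b + c + d + k + 2 + 1 + 3 - (b + 1 + (c + 1) + (d + 1)) = k + 3 := by omega
  have e2 : b + c + d + k + 2 + 1 + 1 - (b + 1 + (c + 1) + (d + 1)) = k + 1 := by omega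
  have e3 : b + 1 + (c + 1) + (d + 1) - 3 = b + c + d := by omega
  rw [e1, e3, altProd] at hfg
  -- The fraction field permits division by `1 + t`, and the embedding is injective.
  let φ : ℤ[X] →+* RatFunc ℤ := algebraMap ℤ[X] (RatFunc ℤ)
  have hφ : Function.Injective φ := IsFractionRing.injective ℤ[X] (RatFunc ℤ)
  have hx1 : (1 + X : ℤ[X]) ≠ 0 := by
    rw [add_comm, ← C_1]; exact X_add_C_ne_zero 1
  have hx : 1 + φ X ≠ 0 := by
    rw [← map_one φ, ← map_add]; exact (map_ne_zero_iff φ hφ).2 hx1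
  have hsign : ∀ n : ℕ, (-1 : RatFunc ℤ) ^ n = 1 ∨ (-1 : RatFunc ℤ) ^ n = -1 := neg_one_pow_eq_or _
  have hsq : ∀ n : ℕ, (-1 : RatFunc ℤ) ^ n * (-1) ^ n = 1 := fun n => by
    rw [← mul_pow]; simp
  have hdiv : ∀ {p q : ℤ[X]} {m : ℕ}, p * (1 + X) ^ m = q → φ p = φ q / (1 + φ X) ^ m := by
    intro p q m h
    rw [eq_div_iff (pow_ne_zero _ hx), ← h]
    simp
  have hA : ∀ n, φ (altPoly n) = (φ X ^ n - (-1) ^ n) / (1 + φ X) := fun n => by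
    have := hdiv (m := 1) ((congrArg _ (pow_one _)).trans (altPoly_mul n))
    simpa using this
  have hP : ∀ n, φ (twistPoly n) = (1 - (-1) ^ n * φ X ^ n) / (1 + φ X) := fun n => by
    have := hdiv (m := 1) ((congrArg _ (pow_one _)).trans (twistPoly_mul n))
    rw [neg_pow] at this
    simpa using this
  have hL : ∀ n : ℕ, φ (incPoly ((n : ℤ) - 1)) = _ := fun n => hdiv (incPoly_mul n)
  have hR : ∀ n : ℕ, φ (decPoly ((n : ℤ) - 1)) = _ := fun n => hdiv (decPoly_mul n)
  have hfg' := congrArg φ hfg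
  apply hφ
  have key := block_identity (φ X) (φ X ^ b) (φ X ^ c) (φ X ^ d) (φ X ^ k) ((-1) ^ b) ((-1) ^ c)
    ((-1) ^ d) ((-1) ^ k) (b : RatFunc ℤ) c d hx (hsign b) (hsign c) (hsign d) (hsign k)
    (φ (altPoly (b + c + d + k + 2 + 1))) (φ (altPoly (b + 1))) (φ (altPoly (c + 1)))
    (φ (altPoly (d + 1))) (φ (altPoly (b + 1 + (c + 1)))) (φ (altPoly (c + 1 + (d + 1))))
    (φ (altPoly (k + 1))) (φ (altPoly (k + 3))) (φ (incPoly ((b : ℤ) - 1)))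
    (φ (incPoly ((d : ℤ) - 1))) (φ (decPoly ((b : ℤ) - 1))) (φ (decPoly ((d : ℤ) - 1)))
    (φ (twistPoly (b + c + d + k + 2 + 1))) (φ (twistPoly (b + 1))) (φ (twistPoly (c + 1)))
    (φ (twistPoly (d + 1)))
    (φ (lowPart (b + c + d + k + 2 + 1) (b + 1) (c + 1) (d + 1)))
    (φ (highPart (b + c + d + k + 2 + 1) (b + 1) (c + 1) (d + 1)))
    (by rw [hA]; ring) (by rw [hA]; ring) (by rw [hA]; ring) (by rw [hA]; ring)
    (by rw [hA]; ring) (by rw [hA]; ring) (by rw [hA]; ring) (by rw [hA]; ring)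
    (by rw [hL]; simp; ring) (by rw [hL]; simp; ring) (by rw [hR]; simp; ring) (by rw [hR]; simp; ring)
    (by rw [hP]; ring) (by rw [hP]; ring) (by rw [hP]; ring) (by rw [hP]; ring)
    (by
      simp only [map_mul, map_add, map_pow, eps, map_neg, map_one, map_natCast] at hfg'
      rw [hfg']
      push_cast
      ring)
  -- The signs depend only on the parity of the exponent, so even parts are split off.
  have s1 : eps (b + c + d + k + 2 + 1 + (b + 1) + (c + 1) + (d + 1)) = eps k := by
    rw [eps, eps, show b + c + d + k + 2 + 1 + (b + 1) + (c + 1) + (d + 1) =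
      2 * (b + c + d + 3) + k by omega, pow_add, pow_mul]; simp
  have s2 : eps (b + c + d + k + 2 + 1 + (c + 1)) = eps (b + d + k) := by
    rw [eps, eps, show b + c + d + k + 2 + 1 + (c + 1) =
      2 * (c + 2) + (b + d + k) by omega, pow_add, pow_mul]; simp
  have s3 : eps (b + c + d + k + 2 + 1 + (c + 1) - 1) = -eps (b + d + k) := by
    rw [eps, eps, show b + c + d + k + 2 + 1 + (c + 1) - 1 =
      2 * (c + 1) + 1 + (b + d + k) by omega, pow_add, pow_add, pow_mul]; simp
  have s4 : eps (b + c + d + k + 2 + 1 + (c + 1) + (d + 1)) = -eps (b + k) := by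
    rw [eps, eps, show b + c + d + k + 2 + 1 + (c + 1) + (d + 1) =
      2 * (c + d + 2) + 1 + (b + k) by omega, pow_add, pow_add, pow_mul]; simp
  have s5 : eps (b + c + d + k + 2 + 1 + (b + 1) + (c + 1)) = -eps (d + k) := by
    rw [eps, eps, show b + c + d + k + 2 + 1 + (b + 1) + (c + 1) =
      2 * (b + c + 2) + 1 + (d + k) by omega, pow_add, pow_add, pow_mul]; simp
  have i1 : ((b + 1 : ℕ) : ℤ) - 2 = (b : ℤ) - 1 := by push_cast; ring
  have i2 : ((d + 1 : ℕ) : ℤ) - 2 = (d : ℤ) - 1 := by push_cast; ring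
  rw [rankTwoPoly, blockOne, gap, blockTwo, e2, s1, s2, s3, s4, s5, i1, i2]
  simp only [map_add, map_mul, map_sub, map_pow, eps, map_neg, map_one, map_natCast,
    Nat.add_sub_cancel, map_ofNat]
  push_cast
  refine Eq.trans ?_ (key.trans ?_) <;> ring

/-! ### Degrees of the blocks and the top coefficient -/

lemma natDegree_eps (k : ℕ) : (eps k).natDegree = 0 := by rw [eps_eq_C, natDegree_C]

lemma natDegree_blockOne_le (a b c d : ℕ) :
    (blockOne a (b + 1) (c + 1) (d + 1)).natDegree ≤ b + 1 + (c + 1) + (d + 1) := by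
  have hε := fun k => (natDegree_eps k).le
  have hX := fun n => natDegree_X_pow_le (R := ℤ) n
  have hA := natDegree_altPoly_le
  have i1 : ((b + 1 : ℕ) : ℤ) - 2 = (b : ℤ) - 1 := by push_cast; ring
  have i2 : ((d + 1 : ℕ) : ℤ) - 2 = (d : ℤ) - 1 := by push_cast; ring
  rw [blockOne, i1, i2]
  refine natDegree_add_le_of_degree_le (natDegree_add_le_of_degree_le
    (natDegree_add_le_of_degree_le (natDegree_add_le_of_degree_le (natDegree_add_le_of_degree_le
    (natDegree_add_le_of_degree_le (natDegree_add_le_of_degree_le (natDegree_add_le_of_degree_le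
    (natDegree_add_le_of_degree_le ?_ ?_) ?_) ?_) ?_) ?_) ?_) ?_) ?_) ?_
  · exact (natDegree_mul_le_of_le (hε _) (natDegree_add_le_of_degree_le (n := 2)
      (by simp) (hX 2))).trans (by omega)
  · exact (natDegree_mul_le_of_le (hε _) (hX _)).trans (by omega)
  · exact (natDegree_mul_le_of_le (natDegree_mul_le_of_le (natDegree_mul_le_of_le (hε _) (hX _))
      (hA _)) (hA _)).trans (by omega)
  · exact (natDegree_mul_le_of_le (natDegree_mul_le_of_le (natDegree_mul_le_of_le
      (natDegree_mul_le_of_le (natDegree_ofNat 2).le (hε _)) (hX _)) (hA _)) (hA _)).trans (by omega)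
  · exact (natDegree_mul_le_of_le (natDegree_mul_le_of_le (hε _) (hX _))
      (natDegree_incPoly_le b)).trans (by omega)
  · exact (natDegree_mul_le_of_le (natDegree_mul_le_of_le (natDegree_mul_le_of_le
      (natDegree_natCast _).le (hε _)) (hX _)) (hA _)).trans (by omega)
  · exact (natDegree_mul_le_of_le (natDegree_mul_le_of_le (hε _) (hX _))
      (natDegree_incPoly_le d)).trans (by omega)
  · exact (natDegree_mul_le_of_le (natDegree_mul_le_of_le (natDegree_mul_le_of_le
      (natDegree_natCast _).le (hε _)) (hX _)) (hA _)).trans (by omega)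
  · exact (natDegree_mul_le_of_le (hX _) (natDegree_lowPart_le _ _ _ _)).trans (by omega)
  · exact (natDegree_mul_le_of_le (natDegree_mul_le_of_le (hε _) (natDegree_natCast _).le)
      (hX _)).trans (by omega)

lemma natDegree_gap_le {a b c d : ℕ} (ha : b + c + d ≤ a) :
    (gap a b c d).natDegree ≤ a - (b + c + d) := by
  rw [gap]
  exact (natDegree_mul_le_of_le (natDegree_mul_le_of_le (natDegree_eps _).le (natDegree_C _).le)
    (natDegree_altPoly_le _)).trans (by omega)

/-- For `b = c = d = 1` the product vanishes, while adding the degrees of the factors would only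
give the bound `1`; hence the argument by coefficients. -/
lemma natDegree_X_mul_highPart_le (a b c d : ℕ) :
    (X * highPart a b c d).natDegree ≤ b + c + d - 3 := by
  refine natDegree_le_iff_coeff_eq_zero.2 fun n hn => ?_
  obtain ⟨m, rfl⟩ := Nat.exists_eq_succ_of_ne_zero (by omega : n ≠ 0)
  rw [coeff_X_mul, highPart_coeff, if_neg (by omega)]

lemma natDegree_blockTwo_le (a b c d : ℕ) :
    (blockTwo a (b + 1) (c + 1) (d + 1)).natDegree ≤ b + c + d := by
  have hε := fun k => (natDegree_eps k).le
  have hA := natDegree_altPoly_le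
  have i1 : ((b + 1 : ℕ) : ℤ) - 2 = (b : ℤ) - 1 := by push_cast; ring
  have i2 : ((d + 1 : ℕ) : ℤ) - 2 = (d : ℤ) - 1 := by push_cast; ring
  rw [blockTwo, i1, i2]
  refine natDegree_add_le_of_degree_le (natDegree_add_le_of_degree_le
    (natDegree_add_le_of_degree_le (natDegree_add_le_of_degree_le (natDegree_add_le_of_degree_le
    (natDegree_add_le_of_degree_le (natDegree_add_le_of_degree_le ?_ ?_) ?_) ?_) ?_) ?_) ?_) ?_
  · exact (natDegree_mul_le_of_le (hε _) (natDegree_X_pow_le _)).trans (by omega)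
  · exact (natDegree_mul_le_of_le (natDegree_mul_le_of_le (hε _) (hA _)) (hA _)).trans (by omega)
  · exact (natDegree_mul_le_of_le (natDegree_mul_le_of_le (hε _) (hA _)) (hA _)).trans (by omega)
  · exact (natDegree_mul_le_of_le (natDegree_mul_le_of_le (hε _) (hA _)) (hA _)).trans (by omega)
  · exact (natDegree_mul_le_of_le (hε _) (natDegree_decPoly_le b)).trans (by omega)
  · exact (natDegree_mul_le_of_le (hε _) (natDegree_decPoly_le d)).trans (by omega)
  · exact (natDegree_mul_le_of_le (hε _) (natDegree_natCast _).le).trans (by omega)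
  · exact (natDegree_X_mul_highPart_le _ _ _ _).trans (by omega)

lemma eps_mul_pair_coeff (p q r : ℕ) :
    (eps (r + 1) * altPoly (p + 1) * altPoly (q + 1)).coeff (p + q + r) =
      if r = 0 then -1 else 0 := by
  rw [mul_assoc, eps_eq_C, coeff_C_mul]
  split_ifs with h
  · subst h
    rw [add_zero, coeff_mul_add_eq_of_natDegree_le (natDegree_altPoly_succ_le _)
      (natDegree_altPoly_succ_le _), altPoly_coeff_top, altPoly_coeff_top]
    norm_num
  · rw [coeff_eq_zero_of_natDegree_lt, mul_zero]
    exact (natDegree_mul_le_of_le (natDegree_altPoly_succ_le p)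
      (natDegree_altPoly_succ_le q)).trans_lt (by omega)

/-- A product of two of the `A`'s reaches the top degree only if the third exponent is `1`, and then
contributes `-1`; the monomial reaches it only if `b = d = 1` in the unshifted exponents, and the
`R` terms never do. The constant and `t g` together always contribute `1`. -/
lemma blockTwo_coeff_top (a b c d : ℕ) :
    (blockTwo (a + 1) (b + 1) (c + 1) (d + 1)).coeff (b + c + d) =
      (if b + d = 0 then 1 else 0) + (if d = 0 then -1 else 0) + (if c = 0 then -1 else 0)
        + (if b = 0 then -1 else 0) + 1 := by
  have i1 : ((b + 1 : ℕ) : ℤ) - 2 = (b : ℤ) - 1 := by push_cast; ring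
  have i2 : ((d + 1 : ℕ) : ℤ) - 2 = (d : ℤ) - 1 := by push_cast; ring
  have h1 : (eps (b + 1 + (d + 1)) * X ^ (c + 1 - 1)).coeff (b + c + d) =
      if b + d = 0 then 1 else 0 := by
    rw [eps_eq_C, coeff_C_mul, coeff_X_pow]
    by_cases h : b + d = 0
    · rw [if_pos h, if_pos (by omega), show b + 1 + (d + 1) = 2 by omega]; norm_num
    · rw [if_neg h, if_neg (by omega), mul_zero]
  have h2 := eps_mul_pair_coeff b c d
  have h3 := eps_mul_pair_coeff b d c
  have h4 := eps_mul_pair_coeff c d b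
  rw [show b + d + c = b + c + d by ring] at h3
  rw [show c + d + b = b + c + d by ring] at h4
  have h5 : (eps (c + 1 + (d + 1)) * decPoly ((b : ℤ) - 1)).coeff (b + c + d) = 0 := by
    rw [eps_eq_C, coeff_C_mul, decPoly_coeff_of_le (by omega), mul_zero]
  have h6 : (eps (b + 1 + (c + 1)) * decPoly ((d : ℤ) - 1)).coeff (b + c + d) = 0 := by
    rw [eps_eq_C, coeff_C_mul, decPoly_coeff_of_le (by omega), mul_zero]
  have h7 : (eps (1 + (b + 1 + (c + 1) + (d + 1))) * (((b + 1) * (c + 1) * (d + 1) : ℕ) : ℤ[X])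
      + X * highPart (a + 1) (b + 1) (c + 1) (d + 1)).coeff (b + c + d) = 1 := by
    rw [coeff_add, eps_eq_C, ← C_eq_natCast, ← C_mul, coeff_C]
    -- If the top degree is `0`, then `g = 0` and the `1` is the constant `bcd`; otherwise it is the
    -- leading coefficient of `g`.
    by_cases h : b + c + d = 0
    · obtain ⟨rfl, rfl, rfl⟩ : b = 0 ∧ c = 0 ∧ d = 0 := by omega
      rw [(parts_eq_zero _).2]
      simp
    · obtain ⟨n, hn⟩ := Nat.exists_eq_succ_of_ne_zero h
      rw [if_neg h, zero_add, hn, coeff_X_mul]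
      have := highPart_coeff_top (a := a) h
      rwa [hn] at this
  rw [blockTwo, i1, i2, add_assoc _ (eps (1 + _) * _), coeff_add, h7, coeff_add, h6, coeff_add, h5,
    coeff_add, h4, coeff_add, h3, coeff_add, h2, h1, add_zero, add_zero]

end TwistedLinks

theorem mainTheorem5 (a b c d : ℕ) (hb : 0 < b) (hc : 0 < c) (hd : 0 < d) (ha : b + c + d ≤ a) :
    -- the coefficient vector is a polynomial, and it splits into two blocks and a gap
    (∃ V : ℤ[X], jonesStar (rankTwoWord a b c d) = inQuarterPowers V ∧
      V = blockOne a b c d + X ^ (b + c + d + 1) * gap a b c d + X ^ (a + 2) * blockTwo a b c d ∧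
      -- degree bound, and when it is attained
      V.degree ≤ ((a + b + c + d - 1 : ℕ) : WithBot ℕ) ∧
      (V.degree = ((a + b + c + d - 1 : ℕ) : WithBot ℕ) ↔
        (min b d = 1 ∧ c = 1) ∨ 2 ≤ min b (min c d))) ∧
    -- the three summands occupy disjoint ranges of degrees
    (blockOne a b c d).degree ≤ ((b + c + d : ℕ) : WithBot ℕ) ∧
    (gap a b c d).degree ≤ ((a - (b + c + d) : ℕ) : WithBot ℕ) ∧
    (blockTwo a b c d).degree ≤ ((b + c + d - 3 : ℕ) : WithBot ℕ) ∧
    -- the polynomials `f` and `g` that enter the blocks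
    altProd a b c d = lowPart a b c d
      + eps (3 + (b + c + d)) * ((b * c * d : ℕ) : ℤ[X]) * X ^ (b + c + d - 3)
        * altPoly (a + 3 - (b + c + d))
      + X ^ a * highPart a b c d ∧
    (b = 1 ∧ c = 1 ∧ d = 1 → lowPart a b c d = 0 ∧ highPart a b c d = 0) ∧
    (¬ (b = 1 ∧ c = 1 ∧ d = 1) →
      (lowPart a b c d).degree = ((b + c + d - 4 : ℕ) : WithBot ℕ) ∧
      (highPart a b c d).degree = ((b + c + d - 4 : ℕ) : WithBot ℕ)) ∧
    -- the links of the two degenerate cases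
    (b = 1 ∧ c = 1 ∧ d = 1 →
      SameClosure (rankTwoWord a b c d) (twoStrandTorusWord (a + 2))) ∧
    (min b d = 1 ∧ c = 1 →
      SameClosure (rankTwoWord a b c d) (twoStrandTorusWord (a + b + c + d - 1))) := by
  obtain ⟨b, rfl⟩ := Nat.exists_eq_succ_of_ne_zero hb.ne'
  obtain ⟨c, rfl⟩ := Nat.exists_eq_succ_of_ne_zero hc.ne'
  obtain ⟨d, rfl⟩ := Nat.exists_eq_succ_of_ne_zero hd.ne'
  obtain ⟨a, rfl⟩ := Nat.exists_eq_succ_of_ne_zero (by omega : a ≠ 0)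
  simp only [Nat.succ_eq_add_one] at *
  have h1 := natDegree_blockOne_le (a + 1) b c d
  have h2 := natDegree_gap_le ha
  have h3 := natDegree_blockTwo_le (a + 1) b c d
  have hV := rankTwoPoly_eq_blocks ha
  have hdeg : (rankTwoPoly (a + 1) (b + 1) (c + 1) (d + 1)).degree ≤
      ((a + 1 + (b + 1) + (c + 1) + (d + 1) - 1 : ℕ) : WithBot ℕ) := by
    rw [hV]
    refine degree_le_of_natDegree_le (natDegree_add_le_of_degree_le
      (natDegree_add_le_of_degree_le ?_ ?_) ?_)
    · omega
    · exact (natDegree_mul_le_of_le (natDegree_X_pow_le _) h2).trans (by omega)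
    · exact (natDegree_mul_le_of_le (natDegree_X_pow_le _) h3).trans (by omega)
  have hcoeff : (rankTwoPoly (a + 1) (b + 1) (c + 1) (d + 1)).coeff
      (a + 1 + (b + 1) + (c + 1) + (d + 1) - 1) =
      (if b + d = 0 then 1 else 0) + (if d = 0 then -1 else 0) + (if c = 0 then -1 else 0)
        + (if b = 0 then -1 else 0) + 1 := by
    rw [hV, coeff_add, coeff_add, coeff_eq_zero_of_natDegree_lt (h1.trans_lt (by omega)),
      coeff_eq_zero_of_natDegree_lt ((natDegree_mul_le_of_le (natDegree_X_pow_le _) h2).trans_lt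
        (by omega)),
      show a + 1 + (b + 1) + (c + 1) + (d + 1) - 1 = (b + c + d) + (a + 1 + 2) by omega,
      coeff_X_pow_mul, blockTwo_coeff_top, zero_add, zero_add]
  refine ⟨⟨_, jonesStar_rankTwoWord _ _ _ _, hV, hdeg, ?_⟩, degree_le_of_natDegree_le h1,
    degree_le_of_natDegree_le h2, degree_le_of_natDegree_le (h3.trans (by omega)),
    altProd_decomposition ha, ?_, ?_, ?_, ?_⟩
  -- Given the degree bound, equality means that the coefficient in `hcoeff` is nonzero.
  · have hiff : ∀ {p : ℤ[X]} {n : ℕ}, p.degree ≤ n → (p.degree = n ↔ p.coeff n ≠ 0) := fun h =>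
      ⟨coeff_ne_zero_of_eq_degree, degree_eq_of_le_of_coeff_ne_zero h⟩
    rw [hiff hdeg, hcoeff]
    -- The coefficient is `1` if all three exponents are at least `2`, `-1` if `c` and one of `b, d`
    -- equal `1`, and `0` in all other cases.
    split_ifs <;> norm_num <;> omega
  · rintro ⟨hb, hc, hd⟩
    rw [hb, hc, hd]
    exact parts_eq_zero _
  · intro h
    exact ⟨lowPart_degree (by omega) (by omega), highPart_degree (by omega)⟩
  · rintro ⟨hb, hc, hd⟩
    have := sameClosure_of_last_eq_one (a + 1) 1
    rw [hb, hc, hd]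
    rwa [show 1 + (a + 1 + 1) = a + 1 + 2 by omega] at this
  · rintro ⟨hbd, hc⟩
    rw [hc]
    rcases (by omega : d = 0 ∨ b = 0) with rfl | rfl
    · have := sameClosure_of_last_eq_one (a + 1) (b + 1)
      rwa [show b + 1 + (a + 1 + 1) = a + 1 + (b + 1) + 1 + (0 + 1) - 1 by omega] at this
    · have := sameClosure_of_first_eq_one (a + 1) (d + 1)
      rwa [show 1 + (a + 1 + (d + 1)) = a + 1 + (0 + 1) + 1 + (d + 1) - 1 by omega] at this
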